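/- Let $0<x\le 1$, let $y\in\mathbb{R}$ with $y\neq 0$, and put $z=x+iy$. Let $P$ be the set of odd primes and let $p_1<p_2<p_3<\cdots$ be its elements in increasing order. A rearrangement of a series $\sum_{i\ge 1} a_i$ is a series $\sum_{i\ge 1} a_{\sigma(i)}$ with $\sigma$ a permutation of $\{1,2,3,\dots\}$; a series converges if its partial sums have a limit in $\mathbb{C}$. Then: 1. the series $\rho(z)=\dfrac{1}{2^{z}}+\sum_{i=1}^{\infty}\dfrac{1}{p_i^{z}}$ (with first term $2^{-z}$ and $(i+1)$-st term $p_i^{-z}$) has a convergent rearrangement; 2. the series $\sum_{i=1}^{\infty}\dfrac{1}{p_i^{z}}$ has a convergent rearrangement; 3. in other words, there is an ordering $P=\{p'_1,p'_2,p'_3,\dots\}$ (a bijection $i\mapsto p'_i$ from $\{1,2,3,\dots\}$ onto $P$) such that $\sum_{i=1}^{\infty}\dfrac{1}{(p'_i)^{z}}$ converges. -/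

import Mathlib

open Filter Topology

/-- The sequence of partial sums `a 0 + ⋯ + a (n - 1)` has a limit in `ℂ`. -/
def SeriesConverges (a : ℕ → ℂ) : Prop :=
  ∃ L : ℂ, Tendsto (fun n : ℕ => ∑ i ∈ Finset.range n, a i) atTop (𝓝 L)

/-- Some rearrangement of the series `∑ a i`, by a permutation of the index set, converges. -/
def HasConvergentRearrangement (a : ℕ → ℂ) : Prop :=
  ∃ σ : Equiv.Perm ℕ, SeriesConverges (fun i => a (σ i))

/-- The set `P` of odd primes. -/
def oddPrimes : Set ℕ := {p | p.Prime ∧ Odd p}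

/-- The odd primes in increasing order, indexed from `0`: `3, 5, 7, 11, …`. -/
noncomputable def oddPrimeSeq (i : ℕ) : ℕ := Nat.nth (fun p => p ∈ oddPrimes) i

/-- The terms of the series `ρ(z) = 2^{-z} + ∑ p_i^{-z}`, where `p_i` runs through the odd primes
in increasing order. -/
noncomputable def rhoTerm (z : ℂ) : ℕ → ℂ
  | 0 => 1 / (2 : ℂ) ^ z
  | i + 1 => 1 / (oddPrimeSeq i : ℂ) ^ z

/-! The terms tend to `0`, and for every unit `u` those with `Re (u * a n) ≥ ‖a n‖ / 4` have
infinite total length. So a partial sum `S ≠ 0` can be steered towards `0` by small unused terms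
from the cone around `-S`, without ever exceeding `‖S‖`. Alternating this with the forced insertion
of each index in turn gives a rearrangement with sum `0`
(`hasConvergentRearrangement_of_not_summable_cone`).

The divergence in cones (`not_summable_one_div_primes_cone`) holds because `-ζ'/ζ` has `s = 1` as
its only pole on `Re s = 1`. With `c = Re (u n^(-iy))`, the polynomial `(c - 1/4)(c + 1)` has
constant Fourier coefficient `1/4 > 0` but is positive only in the cone. Its average against `(s -
1) Λ(n) n^(-s)` tends to `1/4` as `s → 1+`, whereas summable reciprocals of the cone primes would
make the cone's share tend to `0`. -/

/-! ### Rearranging a null sequence in the plane. -/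

/-- The list `M` extends `L` without repetition, and no partial sum of `a` along the extension
exceeds the sum along `L` in norm. -/
def TameExtension (a : ℕ → ℂ) (L M : List ℕ) : Prop :=
  L <+: M ∧ M.Nodup ∧ ∀ P, L <+: P → P <+: M → ‖(P.map a).sum‖ ≤ ‖(L.map a).sum‖

lemma TameExtension.trans {a : ℕ → ℂ} {L M N : List ℕ} (h₁ : TameExtension a L M)
    (h₂ : TameExtension a M N) : TameExtension a L N := by
  refine ⟨h₁.1.trans h₂.1, h₂.2.1, fun P hLP hPN => ?_⟩
  rcases List.prefix_or_prefix_of_prefix hPN h₂.1 with h | h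
  · exact h₁.2.2 P hLP h
  · exact (h₂.2.2 P h hPN).trans (h₁.2.2 M h₁.1 List.prefix_rfl)

lemma TameExtension.refl {a : ℕ → ℂ} {L : List ℕ} (hL : L.Nodup) : TameExtension a L L := by
  refine ⟨List.prefix_rfl, hL, fun P h₁ h₂ => ?_⟩
  rw [h₁.eq_of_length_le h₂.length_le]

/-- The effect of adding to `S` a vector `A` from the cone of directions around `-S`. -/
lemma norm_add_sq_le_of_re_le {S A u : ℂ} {T : ℝ} (hu : ‖u‖ = 1)
    (hS : S * u = -(‖S‖ : ℂ)) (hA : ‖A‖ ≤ T) (hAu : T / 4 ≤ (u * A).re) :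
    ‖S + A‖ ^ 2 ≤ ‖S‖ ^ 2 - ‖S‖ * T / 2 + T ^ 2 := by
  have h : ‖S + A‖ = ‖-(‖S‖ : ℂ) + u * A‖ := by
    rw [← hS, mul_comm S u, ← mul_add, norm_mul, hu, one_mul]
  have hA' : ‖u * A‖ ≤ T := by rwa [norm_mul, hu, one_mul]
  have h2 : ‖u * A‖ ^ 2 ≤ T ^ 2 := pow_le_pow_left₀ (norm_nonneg _) hA' 2
  rw [h]
  rw [Complex.sq_norm, Complex.normSq_apply] at h2 ⊢
  simp only [Complex.add_re, Complex.neg_re, Complex.ofReal_re, Complex.add_im, Complex.neg_im,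
    Complex.ofReal_im, neg_zero, zero_add]
  nlinarith [norm_nonneg S]

/-- A set of least cardinality with sum at least `r` works: dropping any element, worth at most `r`,
brings the sum below `r`. -/
lemma exists_finset_sum_mem_Icc {f : ℕ → ℝ} {C : Set ℕ} {r : ℝ}
    (hf : ∀ n, 0 ≤ f n) (hC : ∀ n ∈ C, f n ≤ r)
    (hdiv : ¬ Summable (C.indicator f)) :
    ∃ G : Finset ℕ, ↑G ⊆ C ∧ r ≤ ∑ n ∈ G, f n ∧ ∑ n ∈ G, f n ≤ 2 * r := by
  classical
  have hex : ∃ k : ℕ, ∃ G : Finset ℕ, ↑G ⊆ C ∧ r ≤ ∑ n ∈ G, f n ∧ G.card = k := by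
    by_contra hcon
    push Not at hcon
    refine hdiv (summable_of_sum_le (c := r)
      (fun n => Set.indicator_nonneg (fun n _ => hf n) n) fun u => ?_)
    by_contra hlt
    refine hcon (u.filter (· ∈ C)).card (u.filter (· ∈ C)) ?_ ?_ rfl
    · intro n hn
      simp only [Finset.coe_filter] at hn
      exact hn.2
    · rw [Finset.sum_filter]
      push Not at hlt
      simpa only [Set.indicator_apply] using hlt.le
  obtain ⟨G, hGC, hGr, hGk⟩ := Nat.find_spec hex
  refine ⟨G, hGC, hGr, ?_⟩
  rcases G.eq_empty_or_nonempty with rfl | ⟨m, hm⟩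
  · simp only [Finset.sum_empty] at hGr ⊢
    by_contra hneg
    push Not at hneg
    refine hdiv (summable_zero.congr fun n => ?_)
    by_cases hn : n ∈ C
    · linarith [hf n, hC n hn]
    · simp [hn]
  · have hlt : ∑ n ∈ G.erase m, f n < r := by
      by_contra hge
      push Not at hge
      refine Nat.find_min hex (m := (G.erase m).card) ?_ ⟨G.erase m, ?_, hge, rfl⟩
      · rw [← hGk]; exact Finset.card_erase_lt_of_mem hm
      · exact fun n hn => hGC (Finset.erase_subset m G hn)
    rw [← Finset.add_sum_erase G f hm]
    linarith [hC m (hGC hm)]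

section Rearrangement

variable {a : ℕ → ℂ} (ha : Tendsto a atTop (𝓝 0))
  (hdiv : ∀ u : ℂ, ‖u‖ = 1 → ¬ Summable ({n | ‖a n‖ / 4 ≤ (u * a n).re}.indicator fun n => ‖a n‖))

include ha hdiv

lemma exists_tameExtension_contracting {L : List ℕ} (hL : L.Nodup) :
    ∃ M, TameExtension a L M ∧ ‖(M.map a).sum‖ ^ 2 ≤ 61 / 64 * ‖(L.map a).sum‖ ^ 2 := by
  classical
  set S := (L.map a).sum with hSdef
  rcases eq_or_ne S 0 with h0 | h0
  · exact ⟨L, .refl hL, by simp [← hSdef, h0]⟩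
  have hSpos : 0 < ‖S‖ := norm_pos_iff.mpr h0
  -- Multiplication by `u` turns the direction of `-S` into the positive real axis.
  set u : ℂ := -(‖S‖ : ℂ) / S with hu
  have hu1 : ‖u‖ = 1 := by
    rw [hu, norm_div, norm_neg, Complex.norm_real, norm_norm, div_self hSpos.ne']
  have hSu : S * u = -(‖S‖ : ℂ) := by rw [hu]; field_simp
  set r := ‖S‖ / 8 with hr
  have hrpos : 0 < r := by positivity
  set C : Set ℕ := {n | n ∉ L ∧ ‖a n‖ ≤ r ∧ ‖a n‖ / 4 ≤ (u * a n).re} with hC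
  have hCdiv : ¬ Summable (C.indicator fun n => ‖a n‖) := by
    intro hsum
    refine hdiv u hu1 ?_
    have hev : ∀ᶠ n in atTop, n ∉ L ∧ ‖a n‖ ≤ r := by
      have h₁ : ∀ᶠ n in atTop, n ∉ L := by
        have := (L.toFinset.finite_toSet).compl_mem_cofinite
        rw [Nat.cofinite_eq_atTop] at this
        filter_upwards [this] with n hn
        simpa using hn
      have h₂ : ∀ᶠ n in atTop, ‖a n‖ < r := by
        have := ha.norm
        rw [norm_zero] at this
        exact this.eventually_lt_const hrpos
      filter_upwards [h₁, h₂] with n hn₁ hn₂ using ⟨hn₁, hn₂.le⟩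
    refine hsum.congr_atTop ?_
    filter_upwards [hev] with n hn
    simp only [Set.indicator_apply, hC, Set.mem_ofPred_eq, hn.1, hn.2, not_false_eq_true, true_and]
  obtain ⟨G, hGC, hGr, hG2⟩ := exists_finset_sum_mem_Icc (f := fun n => ‖a n‖) (r := r)
    (fun n => norm_nonneg _) (fun n hn => hn.2.1) hCdiv
  have hcone : ∀ Q : List ℕ, (∀ n ∈ Q, n ∈ C) →
      ‖(Q.map a).sum‖ ≤ (Q.map fun n => ‖a n‖).sum ∧
        (Q.map fun n => ‖a n‖).sum / 4 ≤ (u * (Q.map a).sum).re := by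
    intro Q
    induction Q with
    | nil => simp
    | cons q Q ih =>
      intro hQ
      obtain ⟨ih₁, ih₂⟩ := ih fun n hn => hQ n (List.mem_cons_of_mem _ hn)
      have hq := (hQ q List.mem_cons_self).2.2
      simp only [List.map_cons, List.sum_cons, mul_add, Complex.add_re]
      exact ⟨(norm_add_le _ _).trans (by gcongr), by linarith⟩
  have hGsum : (G.toList.map fun n => ‖a n‖).sum = ∑ n ∈ G, ‖a n‖ := by
    rw [Finset.sum_map_toList]
  have hGmem : ∀ n ∈ G.toList, n ∈ C := fun n hn => hGC (Finset.mem_toList.mp hn)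
  refine ⟨L ++ G.toList, ⟨List.prefix_append _ _, ?_, ?_⟩, ?_⟩
  · refine List.Nodup.append hL G.nodup_toList ?_
    intro n hn hn'
    exact (hGmem n hn').1 hn
  · rintro P ⟨Q, rfl⟩ hP
    rw [List.prefix_append_right_inj] at hP
    obtain ⟨h₁, h₂⟩ := hcone Q fun n hn => hGmem n (hP.subset hn)
    have hT : (Q.map fun n => ‖a n‖).sum ≤ 2 * r := by
      refine le_trans ?_ (hGsum.trans_le hG2)
      exact (hP.sublist.map _).sum_le_sum (by simp)
    have hT0 : 0 ≤ (Q.map fun n => ‖a n‖).sum := (norm_nonneg _).trans h₁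
    have := norm_add_sq_le_of_re_le hu1 hSu h₁ h₂
    rw [List.map_append, List.sum_append, ← hSdef]
    refine le_of_sq_le_sq ?_ hSpos.le
    -- The length `T` added so far is at most `2r = ‖S‖/4`, so `T² ≤ ‖S‖ T / 2`.
    nlinarith
  · obtain ⟨h₁, h₂⟩ := hcone G.toList hGmem
    have := norm_add_sq_le_of_re_le hu1 hSu h₁ h₂
    rw [List.map_append, List.sum_append, ← hSdef]
    rw [hGsum] at this
    -- With `‖S‖ = 8r` the bound is `64r² - 4rT + T²`, at most `61r²` for `r ≤ T ≤ 2r`.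
    nlinarith

lemma exists_tameExtension_norm_sum_le {L : List ℕ} (hL : L.Nodup) {η : ℝ} (hη : 0 < η) :
    ∃ M, TameExtension a L M ∧ ‖(M.map a).sum‖ ≤ η := by
  have hiter : ∀ j : ℕ, ∃ M, TameExtension a L M ∧
      ‖(M.map a).sum‖ ^ 2 ≤ (61 / 64) ^ j * ‖(L.map a).sum‖ ^ 2 := by
    intro j
    induction j with
    | zero => exact ⟨L, .refl hL, by simp⟩
    | succ j ih =>
      obtain ⟨M, hM, hM'⟩ := ih
      obtain ⟨N, hN, hN'⟩ := exists_tameExtension_contracting ha hdiv hM.2.1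
      refine ⟨N, hM.trans hN, ?_⟩
      rw [pow_succ (61 / 64 : ℝ)]
      linarith
  have hlim : Tendsto (fun j : ℕ => (61 / 64 : ℝ) ^ j * ‖(L.map a).sum‖ ^ 2) atTop (𝓝 0) := by
    simpa using (tendsto_pow_atTop_nhds_zero_of_lt_one (r := (61 / 64 : ℝ))
      (by norm_num) (by norm_num)).mul_const (‖(L.map a).sum‖ ^ 2)
  obtain ⟨j, hj⟩ := (hlim.eventually_lt_const (pow_pos hη 2)).exists
  obtain ⟨M, hM, hM'⟩ := hiter j
  exact ⟨M, hM, le_of_sq_le_sq (hM'.trans hj.le) hη.le⟩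

/-- Appending `m` costs at most `‖a m‖`; a tame extension then brings the sum below `η`. -/
lemma exists_extension_mem {L : List ℕ} (hL : L.Nodup) (m : ℕ) {η : ℝ} (hη : 0 < η) :
    ∃ M, L <+: M ∧ M.Nodup ∧ m ∈ M ∧ ‖(M.map a).sum‖ ≤ η ∧
      ∀ P, L <+: P → P <+: M → ‖(P.map a).sum‖ ≤ ‖(L.map a).sum‖ + ‖a m‖ := by
  by_cases hm : m ∈ L
  · obtain ⟨M, hM, hMη⟩ := exists_tameExtension_norm_sum_le ha hdiv hL hη
    exact ⟨M, hM.1, hM.2.1, hM.1.subset hm, hMη, fun P h₁ h₂ =>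
      (hM.2.2 P h₁ h₂).trans (le_add_of_nonneg_right (norm_nonneg _))⟩
  · have hLm : (L ++ [m]).Nodup := by
      refine List.Nodup.append hL (List.nodup_singleton m) ?_
      simpa using hm
    have hsum : ‖((L ++ [m]).map a).sum‖ ≤ ‖(L.map a).sum‖ + ‖a m‖ := by
      simpa using norm_add_le (L.map a).sum (a m)
    obtain ⟨M, hM, hMη⟩ := exists_tameExtension_norm_sum_le ha hdiv hLm hη
    refine ⟨M, (List.prefix_append _ _).trans hM.1, hM.2.1, hM.1.subset (by simp), hMη,
      fun P h₁ h₂ => ?_⟩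
    rcases List.prefix_or_prefix_of_prefix h₂ hM.1 with h | h
    · rcases List.prefix_concat_iff.mp h with rfl | h
      · exact hsum
      · rw [← h₁.eq_of_length_le h.length_le]
        exact le_add_of_nonneg_right (norm_nonneg _)
    · exact (hM.2.2 P h h₂).trans hsum

omit ha hdiv in
lemma prefix_of_le_of_prefix_succ {f : ℕ → List ℕ} (hf : ∀ k, f k <+: f (k + 1)) {i j : ℕ}
    (hij : i ≤ j) : f i <+: f j := by
  induction hij with
  | refl => exact List.prefix_rfl
  | step _ ih => exact ih.trans (hf _)

omit ha hdiv in
lemma le_length_of_mem_of_prefix_succ {f : ℕ → List ℕ} (hf : ∀ k, f k <+: f (k + 1))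
    (hnd : ∀ k, (f k).Nodup) (hmem : ∀ k, k ∈ f (k + 1)) (n : ℕ) : n ≤ (f n).length := by
  have : Finset.range n ⊆ (f n).toFinset := by
    intro m hm
    rw [List.mem_toFinset]
    exact (prefix_of_le_of_prefix_succ hf (Finset.mem_range.mp hm)).subset (hmem m)
  simpa [List.toFinset_card_of_nodup (hnd n)] using Finset.card_le_card this

omit ha hdiv in
/-- A growing sequence of lists without repetition that exhausts `ℕ` enumerates `ℕ`. -/
lemma exists_perm_of_prefix_succ {f : ℕ → List ℕ} (hf : ∀ k, f k <+: f (k + 1))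
    (hnd : ∀ k, (f k).Nodup) (hmem : ∀ k, k ∈ f (k + 1)) :
    ∃ σ : Equiv.Perm ℕ, ∀ k n, n ≤ (f k).length → (List.range n).map σ = (f k).take n := by
  have hmono {i j} (hij : i ≤ j) : f i <+: f j := prefix_of_le_of_prefix_succ hf hij
  have hlen := le_length_of_mem_of_prefix_succ hf hnd hmem
  let s : ℕ → ℕ := fun n => (f (n + 1))[n]'(hlen (n + 1))
  have hs : ∀ k n (h : n < (f k).length), s n = (f k)[n] := by
    intro k n h
    rcases le_total k (n + 1) with hk | hk
    · exact ((hmono hk).getElem h).symm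
    · exact (hmono hk).getElem (hlen (n + 1))
  have hbij : Function.Bijective s := by
    constructor
    · intro i j hij
      have hi : i < (f (max i j + 1)).length := (Nat.lt_succ_of_le (le_max_left i j)).trans_le
        (hlen _)
      have hj : j < (f (max i j + 1)).length := (Nat.lt_succ_of_le (le_max_right i j)).trans_le
        (hlen _)
      rw [hs _ i hi, hs _ j hj] at hij
      exact (hnd _).getElem_inj_iff.mp hij
    · intro m
      obtain ⟨i, hi, him⟩ := List.mem_iff_getElem.mp (hmem m)
      exact ⟨i, (hs _ i hi).trans him⟩
  refine ⟨Equiv.ofBijective s hbij, fun k n hn => ?_⟩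
  refine List.ext_getElem (by simp [hn]) fun i h₁ h₂ => ?_
  simp only [List.length_take] at h₂
  simp [hs k i (by omega)]

/-- A null sequence whose terms in every cone of directions have infinite total length can be
rearranged into a convergent series. -/
theorem hasConvergentRearrangement_of_not_summable_cone : HasConvergentRearrangement a := by
  have hstep : ∀ (k : ℕ) (L : {L : List ℕ // L.Nodup}), ∃ M : {L : List ℕ // L.Nodup},
      L.1 <+: M.1 ∧ k ∈ M.1 ∧ ‖(M.1.map a).sum‖ ≤ 1 / ((k : ℝ) + 1) ∧
      ∀ P, L.1 <+: P → P <+: M.1 → ‖(P.map a).sum‖ ≤ ‖(L.1.map a).sum‖ + ‖a k‖ := by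
    rintro k ⟨L, hL⟩
    obtain ⟨M, h₁, h₂, h₃, h₄, h₅⟩ := exists_extension_mem ha hdiv hL k
      (η := 1 / ((k : ℝ) + 1)) (by positivity)
    exact ⟨⟨M, h₂⟩, h₁, h₃, h₄, h₅⟩
  choose g hg₁ hg₂ hg₃ hg₄ using hstep
  let F : ℕ → {L : List ℕ // L.Nodup} := fun n => Nat.rec ⟨[], List.nodup_nil⟩ g n
  have hF : ∀ k, F (k + 1) = g k (F k) := fun k => rfl
  have hpre : ∀ k, (F k).1 <+: (F (k + 1)).1 := fun k => hF k ▸ hg₁ k (F k)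
  have hmem : ∀ k, k ∈ (F (k + 1)).1 := fun k => hF k ▸ hg₂ k (F k)
  have hlen := le_length_of_mem_of_prefix_succ (f := fun k => (F k).1) hpre (fun k => (F k).2) hmem
  obtain ⟨σ, hσ⟩ := exists_perm_of_prefix_succ (f := fun k => (F k).1) hpre (fun k => (F k).2) hmem
  have hsum : ∀ k n, n ≤ (F k).1.length →
      ∑ i ∈ Finset.range n, a (σ i) = (((F k).1.take n).map a).sum := by
    intro k n hn
    rw [← hσ k n hn, List.map_map]
    rfl
  refine ⟨σ, 0, Metric.tendsto_atTop.mpr fun ε hε => ?_⟩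
  have ha' : ∀ᶠ k in atTop, ‖a k‖ < ε / 2 := by
    have := ha.norm
    rw [norm_zero] at this
    exact this.eventually_lt_const (half_pos hε)
  obtain ⟨K, hK⟩ := eventually_atTop.mp <| ha'.and <|
    (tendsto_one_div_add_atTop_nhds_zero_nat (𝕜 := ℝ)).eventually_lt_const (half_pos hε)
  refine ⟨(F (K + 1)).1.length, fun n hn => ?_⟩
  have hex : ∃ j, n < (F j).1.length := ⟨n + 1, hlen (n + 1)⟩
  -- The list `F (K + 1 + i)` is the output of stage `K + i`, so its sum is at most `1 / (K + i +
  -- 1)`; up to `n`, stage `K + 1 + i` adds at most `‖a (K + 1 + i)‖` to this bound.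
  obtain ⟨i, hi⟩ : ∃ i, Nat.find hex = K + 1 + i + 1 := by
    have : K + 1 < Nat.find hex := by
      by_contra hle
      push Not at hle
      have h₁ := (prefix_of_le_of_prefix_succ (f := fun k => (F k).1) hpre hle).length_le
      have h₂ := Nat.find_spec hex
      omega
    exact ⟨Nat.find hex - (K + 2), by omega⟩
  have h₁ : n < (F (K + 1 + i + 1)).1.length := hi ▸ Nat.find_spec hex
  have h₂ : (F (K + 1 + i)).1.length ≤ n := by
    have := Nat.find_min hex (m := K + 1 + i) (by omega)
    omega
  have h₃ : (F (K + 1 + i)).1 <+: (F (K + 1 + i + 1)).1.take n :=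
    List.prefix_of_prefix_length_le (hpre _) (List.take_prefix _ _) (by
      rw [List.length_take]; omega)
  have h₄ := hg₄ (K + 1 + i) (F (K + 1 + i)) _ h₃ (by rw [← hF]; exact List.take_prefix _ _)
  have h₅ := hg₃ (K + i) (F (K + i))
  rw [← hF, show K + i + 1 = K + 1 + i by ring] at h₅
  rw [dist_zero_right, hsum (K + 1 + i + 1) n h₁.le]
  linarith [(hK (K + 1 + i) (by omega)).1, (hK (K + i) (by omega)).2]

end Rearrangement

/-! ### Primes with `p^(-iy)` in a cone, via `-ζ'/ζ` on `Re s = 1`. -/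

open ArithmeticFunction vonMangoldt in
/-- On the line `Re s = 1` the function `-ζ'/ζ` has a simple pole with residue `1` at `s = 1`
and no other pole. -/
lemma tendsto_sub_one_mul_LSeries_vonMangoldt (t : ℝ) :
    Tendsto (fun s : ℝ => ((s : ℂ) - 1) * LSeries (fun n => (vonMangoldt n : ℂ)) (s + t * Complex.I))
      (𝓝[>] 1) (𝓝 (if t = 0 then 1 else 0)) := by
  -- Modulus `1` gives `-ζ'/ζ - 1/(s - 1)`; its continuity up to `Re s = 1` encodes the nonvanishing
  -- of `ζ` there.
  have hcont := continuousOn_LFunctionResidueClassAux (q := 1) (1 : ZMod 1)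
  have haux := eqOn_LFunctionResidueClassAux (q := 1) (a := 1) isUnit_one
  have hline : Tendsto (fun s : ℝ => (s : ℂ) + t * Complex.I) (𝓝[>] 1)
      (𝓝[{s | 1 ≤ s.re}] (1 + t * Complex.I)) := by
    refine tendsto_nhdsWithin_iff.mpr ⟨?_, ?_⟩
    · have : Continuous fun s : ℝ => (s : ℂ) + t * Complex.I := by fun_prop
      simpa using (this.tendsto 1).mono_left nhdsWithin_le_nhds
    · filter_upwards [self_mem_nhdsWithin] with s hs
      simpa using (le_of_lt hs)
  have h₁ := ((hcont (1 + t * Complex.I) (by simp)).tendsto).comp hline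
  have hsub : Tendsto (fun s : ℝ => (s : ℂ) - 1) (𝓝[>] 1) (𝓝 0) := by
    have : Continuous fun s : ℝ => (s : ℂ) - 1 := by fun_prop
    simpa using (this.tendsto 1).mono_left nhdsWithin_le_nhds
  have h₂ : Tendsto (fun s : ℝ => ((s : ℂ) - 1) / (s + t * Complex.I - 1)) (𝓝[>] 1)
      (𝓝 (if t = 0 then 1 else 0)) := by
    split_ifs with ht
    · refine tendsto_const_nhds.congr' ?_
      filter_upwards [self_mem_nhdsWithin] with s hs
      have : (s : ℂ) - 1 ≠ 0 := by
        rw [sub_ne_zero]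
        exact_mod_cast (ne_of_gt hs)
      simp [ht, div_self this]
    · have hd : Tendsto (fun s : ℝ => (s : ℂ) + t * Complex.I - 1) (𝓝[>] 1) (𝓝 (t * Complex.I)) := by
        have : Continuous fun s : ℝ => (s : ℂ) + t * Complex.I - 1 := by fun_prop
        simpa using (this.tendsto 1).mono_left nhdsWithin_le_nhds
      rw [← zero_div (t * Complex.I)]
      exact hsub.div hd (by simp [ht])
  have h₃ := (hsub.mul h₁).add h₂
  rw [zero_mul, zero_add] at h₃
  refine h₃.congr' ?_
  filter_upwards [self_mem_nhdsWithin] with s hs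
  have hre : (s : ℂ) + t * Complex.I ∈ {s : ℂ | 1 < s.re} := by simpa using hs
  have hres : (fun n => ((residueClass (1 : ZMod 1) n : ℝ) : ℂ)) = fun n => (vonMangoldt n : ℂ) := by
    funext n
    simp [residueClass, Subsingleton.elim (n : ZMod 1) 1]
  simp only [Function.comp_apply]
  rw [haux hre, hres]
  simp only [Nat.totient_one, Nat.cast_one, inv_one]
  ring

/-- The unimodular number `n ^ (-y i)`. -/
noncomputable def unimodularPow (y : ℝ) (n : ℕ) : ℂ := (n : ℂ) ^ (-(y * Complex.I))

lemma norm_unimodularPow (y : ℝ) {n : ℕ} (hn : n ≠ 0) : ‖unimodularPow y n‖ = 1 := by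
  rw [unimodularPow, Complex.norm_natCast_cpow_of_pos (Nat.pos_of_ne_zero hn)]
  simp

lemma natCast_cpow_neg_eq (s y : ℝ) {n : ℕ} (hn : n ≠ 0) :
    1 / (n : ℂ) ^ ((s : ℂ) + y * Complex.I) = ((1 / (n : ℝ) ^ s : ℝ) : ℂ) * unimodularPow y n := by
  have hn' : (n : ℂ) ≠ 0 := by exact_mod_cast hn
  rw [unimodularPow, Complex.cpow_add _ _ hn', Complex.cpow_neg]
  push_cast
  rw [Complex.ofReal_cpow (Nat.cast_nonneg n)]
  push_cast
  field_simp

lemma unimodularPow_two_mul (y : ℝ) (n : ℕ) :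
    unimodularPow (2 * y) n = unimodularPow y n ^ 2 := by
  rw [unimodularPow, unimodularPow, ← Complex.cpow_nat_mul]
  congr 1
  push_cast
  ring

lemma unimodularPow_zero (n : ℕ) : unimodularPow 0 n = 1 := by simp [unimodularPow]

open ArithmeticFunction

lemma hasSum_vonMangoldt_unimodularPow {s : ℝ} (hs : 1 < s) (y : ℝ) :
    HasSum (fun n : ℕ => ((vonMangoldt n / (n : ℝ) ^ s : ℝ) : ℂ) * unimodularPow y n)
      (LSeries (fun n => (vonMangoldt n : ℂ)) (s + y * Complex.I)) := by
  have hsum : LSeriesSummable (fun n => (vonMangoldt n : ℂ)) (s + y * Complex.I) :=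
    LSeriesSummable_vonMangoldt (by simpa using hs)
  have h : HasSum _ _ := hsum.LSeriesHasSum
  convert h using 1
  funext n
  rcases eq_or_ne n 0 with rfl | hn
  · simp
  · rw [LSeries.term_of_ne_zero hn, div_eq_mul_one_div (vonMangoldt n : ℂ),
      natCast_cpow_neg_eq s y hn, div_eq_mul_one_div, Complex.ofReal_mul, mul_assoc]

/-- The trigonometric polynomial `(c - 1/4) (c + 1)` in `c = Re w`, `‖w‖ = 1`. -/
lemma cone_polynomial_eq {w : ℂ} (hw : ‖w‖ = 1) :
    1 / 4 + 3 / 4 * w.re + 1 / 2 * (w ^ 2).re = (w.re - 1 / 4) * (w.re + 1) := by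
  have h : w.re * w.re + w.im * w.im = 1 := by
    rw [← Complex.normSq_apply, ← Complex.sq_norm, hw, one_pow]
  rw [pow_two, Complex.mul_re]
  linarith

/-- The value of `(s - 1) ∑ Λ(n) n ^ (-s) f(n)` for the trigonometric polynomial
`f = 1 / 4 + 3 / 4 Re (u n ^ (-y i)) + 1 / 2 Re (u n ^ (-y i)) ^ 2`. -/
noncomputable def coneWeight (u : ℂ) (y s : ℝ) : ℂ :=
  1 / 4 * (((s : ℂ) - 1) * LSeries (fun n => (vonMangoldt n : ℂ)) (s + (0 : ℝ) * Complex.I)) +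
    (3 / 4 * u * (((s : ℂ) - 1) * LSeries (fun n => (vonMangoldt n : ℂ)) (s + y * Complex.I)) +
    1 / 2 * u ^ 2 * (((s : ℂ) - 1) *
      LSeries (fun n => (vonMangoldt n : ℂ)) (s + (2 * y : ℝ) * Complex.I)))

/-- Only frequency `0` meets the pole, since `y` and `2y` are nonzero; the constant coefficient
survives. -/
lemma tendsto_coneWeight {y : ℝ} (hy : y ≠ 0) (u : ℂ) :
    Tendsto (fun s => (coneWeight u y s).re) (𝓝[>] 1) (𝓝 (1 / 4)) := by
  have h0 := tendsto_sub_one_mul_LSeries_vonMangoldt 0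
  have h1 := tendsto_sub_one_mul_LSeries_vonMangoldt y
  have h2 := tendsto_sub_one_mul_LSeries_vonMangoldt (2 * y)
  simp only [hy, mul_eq_zero, OfNat.ofNat_ne_zero, or_self, if_true, if_false] at h0 h1 h2
  have h := ((h0.const_mul (1 / 4 : ℂ)).add ((h1.const_mul (3 / 4 * u)).add
    (h2.const_mul (1 / 2 * u ^ 2))))
  have hre := (Complex.continuous_re.tendsto _).comp h
  have hval : (1 / 4 * 1 + (3 / 4 * u * 0 + 1 / 2 * u ^ 2 * 0) : ℂ).re = 1 / 4 := by
    norm_num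
  rw [hval] at hre
  exact hre

lemma hasSum_coneWeight {s : ℝ} (hs : 1 < s) (y : ℝ) (u : ℂ) :
    HasSum (fun n : ℕ => (s - 1) * (vonMangoldt n / (n : ℝ) ^ s) *
      (1 / 4 + 3 / 4 * (u * unimodularPow y n).re + 1 / 2 * ((u * unimodularPow y n) ^ 2).re))
      (coneWeight u y s).re := by
  have h0 := ((hasSum_vonMangoldt_unimodularPow hs 0).mul_left ((s : ℂ) - 1)).mul_left (1 / 4 : ℂ)
  have h1 := ((hasSum_vonMangoldt_unimodularPow hs y).mul_left ((s : ℂ) - 1)).mul_left (3 / 4 * u)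
  have h2 := ((hasSum_vonMangoldt_unimodularPow hs (2 * y)).mul_left ((s : ℂ) - 1)).mul_left
    (1 / 2 * u ^ 2)
  have h := Complex.reCLM.hasSum (h0.add (h1.add h2))
  rw [Complex.reCLM_apply] at h
  rw [coneWeight]
  convert h using 1
  funext n
  simp only [Complex.reCLM_apply, unimodularPow_two_mul, unimodularPow_zero]
  set r := vonMangoldt n / (n : ℝ) ^ s
  set e := unimodularPow y n
  have : (1 / 4 * (((s : ℂ) - 1) * ((r : ℂ) * 1)) + (3 / 4 * u * (((s : ℂ) - 1) * ((r : ℂ) * e)) +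
      1 / 2 * u ^ 2 * (((s : ℂ) - 1) * ((r : ℂ) * e ^ 2)))) =
      (((s - 1) * r : ℝ) : ℂ) * (((1 / 4 : ℝ) : ℂ) + ((3 / 4 : ℝ) : ℂ) * (u * e) +
        ((1 / 2 : ℝ) : ℂ) * (u * e) ^ 2) := by
    push_cast
    ring
  rw [this, Complex.re_ofReal_mul, Complex.add_re, Complex.add_re, Complex.re_ofReal_mul,
    Complex.re_ofReal_mul, Complex.ofReal_re]

lemma summable_vonMangoldt_nonprime_div :
    Summable fun n : ℕ => (if n.Prime then 0 else vonMangoldt n) / (n : ℝ) := by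
  refine (vonMangoldt.summable_residueClass_non_primes_div (1 : ZMod 1)).congr fun n => ?_
  simp [vonMangoldt.residueClass, Subsingleton.elim (n : ZMod 1) 1]

/-- The factor `s - 1` absorbs the logarithm, as `(s - 1) log p ≤ p^(s-1) - 1`; this gives a
majorant independent of `s`. -/
lemma sub_one_mul_vonMangoldt_div_rpow_le {s : ℝ} (hs : 1 < s) (hs2 : s ≤ 2) (n : ℕ) :
    (s - 1) * (vonMangoldt n / (n : ℝ) ^ s) ≤
      (if n.Prime then 1 else vonMangoldt n) / n := by
  rcases eq_or_ne n 0 with rfl | hn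
  · simp
  have hn1 : (1 : ℝ) ≤ n := by exact_mod_cast Nat.one_le_iff_ne_zero.mpr hn
  have hn0 : (0 : ℝ) < n := by linarith
  have hpow : (n : ℝ) ^ s = n ^ (s - 1) * n := by
    rw [← Real.rpow_add_one hn0.ne']
    ring_nf
  have hpos : 0 < (n : ℝ) ^ (s - 1) := Real.rpow_pos_of_pos hn0 _
  rw [hpow, ← div_div, mul_div_assoc']
  refine div_le_div_of_nonneg_right ?_ hn0.le
  rw [mul_div_assoc', div_le_iff₀ hpos]
  split_ifs with hp
  · rw [vonMangoldt_apply_prime hp, ← Real.log_rpow hn0, one_mul]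
    linarith [Real.log_le_sub_one_of_pos hpos]
  · have hΛ : 0 ≤ vonMangoldt n := vonMangoldt_nonneg
    rw [mul_comm]
    refine mul_le_mul_of_nonneg_left ?_ hΛ
    linarith [Real.one_le_rpow hn1 (by linarith : 0 ≤ s - 1)]

/-- The reciprocals of the primes `p` with `p ^ (-y i)` in a cone of directions diverge. -/
theorem not_summable_one_div_primes_cone {y : ℝ} (hy : y ≠ 0) {u : ℂ} (hu : ‖u‖ = 1) :
    ¬ Summable ({n : ℕ | n.Prime ∧ 1 / 4 ≤ (u * unimodularPow y n).re}.indicator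
      fun n => 1 / (n : ℝ)) := by
  classical
  intro hsum
  set C : Set ℕ := {n : ℕ | 1 / 4 ≤ (u * unimodularPow y n).re} with hC
  -- The constant `3/2 = (1 - 1/4)(1 + 1)` is the maximum of the cone polynomial.
  let φ : ℝ → ℕ → ℝ := fun s =>
    C.indicator fun n => 3 / 2 * ((s - 1) * (vonMangoldt n / (n : ℝ) ^ s))
  have hbound : Summable fun n : ℕ => 3 / 2 *
      ({n : ℕ | n.Prime ∧ 1 / 4 ≤ (u * unimodularPow y n).re}.indicator (fun n => 1 / (n : ℝ)) n +
        (if n.Prime then 0 else vonMangoldt n) / (n : ℝ)) :=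
    (hsum.add summable_vonMangoldt_nonprime_div).mul_left _
  have hdom : ∀ᶠ s : ℝ in 𝓝[>] 1, ∀ n, ‖φ s n‖ ≤ 3 / 2 *
      ({n : ℕ | n.Prime ∧ 1 / 4 ≤ (u * unimodularPow y n).re}.indicator (fun n => 1 / (n : ℝ)) n +
        (if n.Prime then 0 else vonMangoldt n) / (n : ℝ)) := by
    filter_upwards [Ioc_mem_nhdsGT (one_lt_two (α := ℝ))] with s hs n
    have hΛ : 0 ≤ vonMangoldt n := vonMangoldt_nonneg
    have hnn : 0 ≤ (if n.Prime then 0 else vonMangoldt n) / (n : ℝ) := by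
      split_ifs <;> positivity
    have hind : 0 ≤ {n : ℕ | n.Prime ∧ 1 / 4 ≤ (u * unimodularPow y n).re}.indicator
        (fun n => 1 / (n : ℝ)) n := Set.indicator_nonneg (fun n _ => by positivity) n
    by_cases hn : n ∈ C
    · have hs1 : 0 ≤ s - 1 := by linarith [hs.1]
      simp only [φ, Set.indicator_of_mem hn]
      rw [Real.norm_of_nonneg (by positivity)]
      refine mul_le_mul_of_nonneg_left ?_ (by norm_num)
      refine (sub_one_mul_vonMangoldt_div_rpow_le hs.1 hs.2 n).trans ?_
      by_cases hp : n.Prime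
      · rw [Set.indicator_of_mem (show n ∈ {n : ℕ | n.Prime ∧ 1 / 4 ≤ (u * unimodularPow y n).re} from ⟨hp, hn⟩)]
        simp [hp]
      · simp only [hp, if_false] at hnn ⊢
        linarith
    · simp only [φ, Set.indicator_of_notMem hn, norm_zero]
      positivity
  have hlim : Tendsto (fun s => ∑' n, φ s n) (𝓝[>] 1) (𝓝 (∑' _ : ℕ, (0 : ℝ))) := by
    refine tendsto_tsum_of_dominated_convergence hbound (fun n => ?_) hdom
    by_cases hn : n ∈ C
    · simp only [φ, Set.indicator_of_mem hn]
      rcases eq_or_ne n 0 with rfl | hn0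
      · simp
      have hn0' : (0 : ℝ) < n := by exact_mod_cast Nat.pos_of_ne_zero hn0
      have hcont : Continuous fun s : ℝ => 3 / 2 * ((s - 1) * (vonMangoldt n / (n : ℝ) ^ s)) := by
        have : Continuous fun s : ℝ => (n : ℝ) ^ s :=
          continuous_const.rpow continuous_id fun _ => .inl hn0'.ne'
        exact continuous_const.mul ((continuous_id.sub continuous_const).mul
          (continuous_const.div this fun s => (Real.rpow_pos_of_pos hn0' s).ne'))
      simpa using (hcont.tendsto 1).mono_left nhdsWithin_le_nhds
    · simp only [φ, Set.indicator_of_notMem hn]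
      exact tendsto_const_nhds
  rw [tsum_zero] at hlim
  have hle : ∀ᶠ s : ℝ in 𝓝[>] 1, (coneWeight u y s).re ≤ ∑' n, φ s n := by
    filter_upwards [hdom, self_mem_nhdsWithin] with s hs hs1
    have hs1 : 1 < s := hs1
    refine hasSum_le (fun n => ?_) (hasSum_coneWeight hs1 y u)
      (Summable.of_norm_bounded hbound hs).hasSum
    -- At `n = 0` the power need not be unimodular, but `Λ(0) = 0`.
    rcases eq_or_ne n 0 with rfl | hn0
    · simp only [φ, Set.indicator_apply]
      simp
    have hw : ‖u * unimodularPow y n‖ = 1 := by rw [norm_mul, hu, norm_unimodularPow y hn0, one_mul]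
    rw [cone_polynomial_eq hw]
    have hΛ : 0 ≤ vonMangoldt n := vonMangoldt_nonneg
    have hs0 : 0 ≤ s - 1 := by linarith
    have hcoef : 0 ≤ (s - 1) * (vonMangoldt n / (n : ℝ) ^ s) := by positivity
    have hre := abs_le.mp ((Complex.abs_re_le_norm (u * unimodularPow y n)).trans_eq hw)
    by_cases hn : n ∈ C
    · simp only [φ, Set.indicator_of_mem hn]
      rw [mul_comm (3 / 2 : ℝ)]
      refine mul_le_mul_of_nonneg_left ?_ hcoef
      nlinarith [hre.1, hre.2]
    · simp only [φ, Set.indicator_of_notMem hn]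
      simp only [hC, Set.mem_ofPred_eq, not_le] at hn
      refine mul_nonpos_of_nonneg_of_nonpos hcoef ?_
      exact mul_nonpos_of_nonpos_of_nonneg (by linarith) (by linarith [hre.1])
  have := le_of_tendsto_of_tendsto (tendsto_coneWeight hy u) hlim hle
  norm_num at this

/-! ### Transfer to the sequence of odd primes. -/

lemma infinite_oddPrimes : oddPrimes.Infinite := by
  refine (Nat.infinite_setOfPred_prime.sdiff (Set.finite_singleton 2)).mono ?_
  rintro p ⟨hp, hp2⟩
  exact ⟨hp, hp.odd_of_ne_two hp2⟩

lemma oddPrimeSeq_injective : Function.Injective oddPrimeSeq :=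
  Nat.nth_injective infinite_oddPrimes

lemma range_oddPrimeSeq : Set.range oddPrimeSeq = oddPrimes :=
  Nat.range_nth_of_infinite infinite_oddPrimes

lemma oddPrimeSeq_mem (i : ℕ) : oddPrimeSeq i ∈ oddPrimes :=
  range_oddPrimeSeq ▸ Set.mem_range_self i

lemma oddPrimeSeq_ne_zero (i : ℕ) : oddPrimeSeq i ≠ 0 := (oddPrimeSeq_mem i).1.ne_zero

lemma norm_one_div_natCast_cpow (x y : ℝ) {n : ℕ} (hn : n ≠ 0) :
    ‖1 / (n : ℂ) ^ ((x : ℂ) + y * Complex.I)‖ = 1 / (n : ℝ) ^ x := by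
  rw [natCast_cpow_neg_eq x y hn, norm_mul, norm_unimodularPow y hn, mul_one, Complex.norm_real,
    Real.norm_of_nonneg (by positivity)]

lemma tendsto_one_div_oddPrimeSeq_cpow {x : ℝ} (hx : 0 < x) (y : ℝ) :
    Tendsto (fun i => 1 / (oddPrimeSeq i : ℂ) ^ ((x : ℂ) + y * Complex.I)) atTop (𝓝 0) := by
  rw [tendsto_zero_iff_norm_tendsto_zero]
  simp only [norm_one_div_natCast_cpow x y (oddPrimeSeq_ne_zero _)]
  have h := (tendsto_rpow_neg_atTop hx).comp
    (tendsto_natCast_atTop_atTop.comp oddPrimeSeq_injective.nat_tendsto_atTop)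
  refine h.congr fun i => ?_
  simp [Real.rpow_neg]

/-- The cone condition depends only on `p^(-iy)`, and `p^(-x) ≥ 1/p` because `x ≤ 1`. -/
lemma not_summable_cone_oddPrimeSeq {x y : ℝ} (hx : x ≤ 1) (hy : y ≠ 0) {u : ℂ} (hu : ‖u‖ = 1) :
    ¬ Summable ({i | ‖1 / (oddPrimeSeq i : ℂ) ^ ((x : ℂ) + y * Complex.I)‖ / 4 ≤
      (u * (1 / (oddPrimeSeq i : ℂ) ^ ((x : ℂ) + y * Complex.I))).re}.indicator
        fun i => ‖1 / (oddPrimeSeq i : ℂ) ^ ((x : ℂ) + y * Complex.I)‖) := by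
  classical
  intro hsum
  set C : Set ℕ := {n : ℕ | n ∈ oddPrimes ∧ 1 / 4 ≤ (u * unimodularPow y n).re}
  have hodd : Summable (C.indicator fun n => 1 / (n : ℝ)) := by
    refine (oddPrimeSeq_injective.summable_iff fun n hn => ?_).mp ?_
    · rw [range_oddPrimeSeq] at hn
      exact Set.indicator_of_notMem (fun h => hn h.1) _
    · refine Summable.of_nonneg_of_le
        (fun i => Set.indicator_nonneg (fun n _ => by positivity) _) (fun i => ?_) hsum
      have hn := oddPrimeSeq_ne_zero i
      have hn1 : (1 : ℝ) ≤ oddPrimeSeq i := by exact_mod_cast Nat.one_le_iff_ne_zero.mpr hn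
      have hpos : 0 < (oddPrimeSeq i : ℝ) ^ x := Real.rpow_pos_of_pos (by linarith) x
      by_cases hi : oddPrimeSeq i ∈ C
      · rw [Function.comp_apply, Set.indicator_of_mem hi, Set.indicator_of_mem]
        · rw [norm_one_div_natCast_cpow x y hn]
          refine one_div_le_one_div_of_le hpos ?_
          simpa using Real.rpow_le_rpow_of_exponent_le hn1 hx
        · rw [Set.mem_ofPred_eq, norm_one_div_natCast_cpow x y hn, natCast_cpow_neg_eq x y hn,
            mul_left_comm, Complex.re_ofReal_mul, div_eq_mul_one_div]
          exact mul_le_mul_of_nonneg_left hi.2 (by positivity)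
      · rw [Function.comp_apply, Set.indicator_of_notMem hi]
        exact Set.indicator_nonneg (fun _ _ => norm_nonneg _) _
  refine not_summable_one_div_primes_cone hy hu (hodd.congr_atTop ?_)
  filter_upwards [eventually_gt_atTop 2] with n hn
  have : n ∈ oddPrimes ↔ n.Prime := ⟨And.left, fun h => ⟨h, h.odd_of_ne_two hn.ne'⟩⟩
  simp only [Set.indicator_apply, C, Set.mem_ofPred_eq, this]

theorem theorem3p2 (x y : ℝ) (hx0 : 0 < x) (hx1 : x ≤ 1) (hy : y ≠ 0) :
    HasConvergentRearrangement (rhoTerm ((x : ℂ) + (y : ℂ) * Complex.I)) ∧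
    HasConvergentRearrangement
      (fun i => 1 / (oddPrimeSeq i : ℂ) ^ ((x : ℂ) + (y : ℂ) * Complex.I)) ∧
    ∃ p : ℕ ≃ oddPrimes,
      SeriesConverges (fun i => 1 / ((p i : ℕ) : ℂ) ^ ((x : ℂ) + (y : ℂ) * Complex.I)) := by
  have hlim := tendsto_one_div_oddPrimeSeq_cpow hx0 y
  have hdiv (u : ℂ) (hu : ‖u‖ = 1) := not_summable_cone_oddPrimeSeq hx1 hy hu
  have hodd := hasConvergentRearrangement_of_not_summable_cone hlim hdiv
  refine ⟨?_, hodd, ?_⟩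
  · refine hasConvergentRearrangement_of_not_summable_cone ?_ fun u hu h => ?_
    · exact (tendsto_add_atTop_iff_nat 1).mp hlim
    · exact hdiv u hu ((summable_nat_add_iff 1).mpr h)
  · obtain ⟨σ, hσ⟩ := hodd
    exact ⟨σ.trans ((Equiv.ofInjective _ oddPrimeSeq_injective).trans
      (Equiv.setCongr range_oddPrimeSeq)), hσ⟩
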